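/- Let $X,Y,Z$ be the Pauli matrices. For $\omega>0$ and a real pulse $\phi$ on $[0,T]$ let $U(t,s)$, $0\le s\le t\le T$, be the propagator of the Hamiltonian $H(t)=\omega(\cos\phi(t)\,X+\sin\phi(t)\,Y)$, that is, $\partial_tU(t,s)=-\mathrm i H(t)U(t,s)$, $U(s,s)=I$. For an integer $L\ge1$ put $h=T/L$ and, for $j=1,\dots,L$, $U_j=U(jh,(j-1)h)$ and $\bar\phi_j=\frac1h\int_{(j-1)h}^{jh}\phi(s)\,\mathrm ds$. Let $C\in\mathbb R$, $\kappa>0$ and $\Theta<\pi$. There is a constant $K>0$, depending only on $C,\kappa,\Theta$, such that the following holds for all $\beta,T,\omega>0$, all $L\ge1$ with $\omega h\le\Theta$, and all $\phi\in C^\infty([0,T])$ with $|\phi^{(k)}|\le C\beta^k$ on $[0,T]$ for every integer $k\ge0$. The propagator exists, and for every $j=1,\dots,L$: (0) There are real $a,b,c$ with $a^2+b^2+c^2<\pi^2$ and $U_j=\exp(-\mathrm i(aX+bY+cZ))$. (1) If $|\bar\phi_j|<\pi/2$ and $\cos\bar\phi_j\ge\kappa$, then for all real $a,b,c$ with $U_j=\exp(-\mathrm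 i(aX+bY+cZ))$ the estimator $\tilde\psi_j=\arctan(b/a)$ (where $\arctan(b/a):=0$ if $a=0$) satisfies $$|\tilde\psi_j-\bar\phi_j|\le K(\beta^2+\omega^2)\beta^2h^4\quad\text{and}\quad|\tilde\psi_j-\bar\phi_j|\le K\,\frac{\beta^2T^2}{L^2}.$$ In particular, if the condition on $\bar\phi_j$ holds for all $j$, then $\max_j|\tilde\psi_j-\bar\phi_j|\le K\beta^2T^2/L^2$; this covers the regime $\omega h\approx\pi/2$. (2) With no condition on $\bar\phi_j$, for all real $a,b,c$ with $a^2+b^2+c^2<\pi^2$ and $U_j=\exp(-\mathrm i(aX+bY+cZ))$, the same two bounds hold modulo $2\pi$ for the estimator $\operatorname{atan2}(b,a)$ (the polar angle of $(a,b)$): there is an integer $k$ such that $|\operatorname{atan2}(b,a)+2\pi k-\bar\phi_j|$ is at most $K(\beta^2+\omega^2)\beta^2h^4$ and at most $K\beta^2T^2/L^2$. -/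

import Mathlib

noncomputable section

namespace AnalogPulse

/-- The Pauli matrix `X`. -/
def pauliX : Matrix (Fin 2) (Fin 2) ℂ := !![0, 1; 1, 0]

/-- The Pauli matrix `Y`. -/
def pauliY : Matrix (Fin 2) (Fin 2) ℂ := !![0, -Complex.I; Complex.I, 0]

/-- The Pauli matrix `Z`. -/
def pauliZ : Matrix (Fin 2) (Fin 2) ℂ := !![1, 0; 0, -1]

/-- The driven two-level Hamiltonian `H_ω[φ(t)] = ω (cos φ(t) X + sin φ(t) Y)`. -/
def hamiltonian (ω : ℝ) (φ : ℝ → ℝ) (t : ℝ) : Matrix (Fin 2) (Fin 2) ℂ :=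
  (ω : ℂ) • ((Real.cos (φ t) : ℂ) • pauliX + (Real.sin (φ t) : ℂ) • pauliY)

/-- `φ` is a Bernstein-type pulse on `[0, T]` with smoothness parameter `β` and prefactor `C`:
it is smooth on `[0, T]` and `|φ⁽ᵏ⁾| ≤ C βᵏ` there for every `k`. The Bernstein class with
parameter `β` is the union of these sets over all `C`. -/
def IsBernsteinPulse (C β T : ℝ) (φ : ℝ → ℝ) : Prop :=
  ContDiffOn ℝ ((⊤ : ℕ∞) : WithTop ℕ∞) φ (Set.Icc 0 T) ∧
    ∀ k : ℕ, ∀ t ∈ Set.Icc (0 : ℝ) T, |iteratedDerivWithin k φ (Set.Icc 0 T) t| ≤ C * β ^ k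

/-- `U t s` is, for `0 ≤ s ≤ t ≤ T`, the time-ordered propagator `𝒯 exp(-i ∫ₛᵗ H_ω[φ(r)] dr)`,
that is, the solution of `∂ₜ U(t, s) = -i H_ω[φ(t)] U(t, s)`, `U(s, s) = 1`. -/
def IsPropagator (T ω : ℝ) (φ : ℝ → ℝ) (U : ℝ → ℝ → Matrix (Fin 2) (Fin 2) ℂ) : Prop :=
  ∀ s ∈ Set.Icc (0 : ℝ) T, U s s = 1 ∧
    ∀ t ∈ Set.Icc s T,
      HasDerivWithinAt (fun r => U r s) ((-Complex.I) • (hamiltonian ω φ t * U t s))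
        (Set.Icc s T) t

/-- The single-qubit unitary `exp(-i (a X + b Y + c Z))` generated by real `a`, `b`, `c`. -/
def expPauli (a b c : ℝ) : Matrix (Fin 2) (Fin 2) ℂ :=
  NormedSpace.exp
    ((-Complex.I) • ((a : ℂ) • pauliX + (b : ℂ) • pauliY + (c : ℂ) • pauliZ))

/-- The average pulse value `h⁻¹ ∫ φ` over the `j`-th segment `[(j - 1) h, j h]`. -/
def segmentAverage (φ : ℝ → ℝ) (h : ℝ) (j : ℕ) : ℝ :=
  h⁻¹ * ∫ s in (((j : ℝ) - 1) * h)..((j : ℝ) * h), φ s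

/-- The propagator over the `j`-th segment `[(j - 1) h, j h]`. -/
def segmentPropagator (U : ℝ → ℝ → Matrix (Fin 2) (Fin 2) ℂ) (h : ℝ) (j : ℕ) :
    Matrix (Fin 2) (Fin 2) ℂ :=
  U ((j : ℝ) * h) (((j : ℝ) - 1) * h)

/-- `atan2 b a`: the polar angle in `(-π, π]` of the point `(a, b)`. -/
def atan2 (b a : ℝ) : ℝ := Complex.arg ⟨a, b⟩

end AnalogPulse

end

namespace AnalogPulse

/-! On one segment rescale time to [0, 1] and put τ = ωh, x = βh, m the mean of the pulse, δ the
pulse minus m. The first column of the propagator, its second entry multiplied by i e^{-im}, becomes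
a pair (u, w) with u' = -τ e^{-iδ} w, w' = τ e^{iδ} u, started at (1, 0). Every generator satisfies
sinc(r)(a + ib) = i U₁₀ = e^{im} w(1), with r² = a² + b² + c², so the error of the estimator is the
argument of w(1). For small x, comparison with δ = 0 bounds Re w(1) below by a multiple of τ; what
remains is Im w(1) = O(τ x² (x² + τ²)).

Time reversal and conjugation show that the phase -δ(1 - s) leads to conj w(1)
(`IsRotation.exists_reversed`). Hence 2i Im w(1) is the difference of two solutions whose phases
differ by δ(s) + δ(1 - s). This symmetric part has mean zero and no linear term, so it is O(x²). To
first order in τ, 2 Im w(1) is τ ∫ (sin δ(s) + sin δ(1 - s)); the zero mean removes the linear part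
of the sines and leaves O(x² · x²). The higher orders keep the factor x² and gain τ²
(`IsRotation.abs_im_le`, `IsRotation.exists_polar`).

When x is not small, a large K makes the bounds trivial, angles being at most π apart. Principal
generators exist since U_j lies in SU(2) and Re u(1) > -1 while τ < π (`IsRotation.neg_one_lt_re`).
-/

/-! ### Exponentials of Pauli combinations -/

open Complex in
theorem pauliCombination_sq (a b c : ℝ) :
    ((-I) • ((a : ℂ) • pauliX + (b : ℂ) • pauliY + (c : ℂ) • pauliZ)) ^ 2 =
      ((-(a ^ 2 + b ^ 2 + c ^ 2) : ℝ) : ℂ) • (1 : Matrix (Fin 2) (Fin 2) ℂ) := by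
  rw [pow_two]
  ext i j
  fin_cases i <;> fin_cases j <;>
    simp [pauliX, pauliY, pauliZ, Matrix.mul_apply, Fin.sum_univ_two] <;>
    ring_nf <;> simp [I_sq] <;> ring

/-- The exponential of a matrix squaring to `-r²`. -/
theorem exp_of_sq_eq_neg_sq (M : Matrix (Fin 2) (Fin 2) ℂ) (r : ℝ)
    (hM : M ^ 2 = ((-r ^ 2 : ℝ) : ℂ) • (1 : Matrix (Fin 2) (Fin 2) ℂ)) (hr : r = 0 → M = 0) :
    NormedSpace.exp M = (Real.cos r : ℂ) • 1 + (Real.sinc r : ℂ) • M := by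
  by_cases h0 : r = 0
  · simp [h0, hr h0]
  have heven : ∀ n : ℕ, M ^ (2 * n) = (((-r ^ 2) ^ n : ℝ) : ℂ) • 1 := by
    intro n
    rw [pow_mul, hM, smul_pow, one_pow, Complex.ofReal_pow]
  have hc : HasSum (fun n : ℕ => (((2 * n).factorial : ℂ)⁻¹) • M ^ (2 * n))
      ((Real.cos r : ℂ) • 1) := by
    have := ((Complex.hasSum_ofReal).2 (Real.hasSum_cos r)).smul_const
      (1 : Matrix (Fin 2) (Fin 2) ℂ)
    convert! this using 1
    ext1 n
    rw [heven, smul_smul]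
    congr 1
    push_cast
    rw [pow_mul, neg_pow]
    ring
  have hs : HasSum (fun n : ℕ => (((2 * n + 1).factorial : ℂ)⁻¹) • M ^ (2 * n + 1))
      ((Real.sinc r : ℂ) • M) := by
    have := ((Complex.hasSum_ofReal).2 ((Real.hasSum_sin r).div_const r)).smul_const M
    rw [Real.sinc_of_ne_zero h0]
    convert! this using 1
    ext1 n
    rw [pow_succ, heven, smul_mul_assoc, one_mul, smul_smul]
    congr 1
    have : (r : ℂ) ≠ 0 := by exact_mod_cast h0
    push_cast
    rw [neg_pow, pow_succ (r : ℂ) (2 * n), pow_mul]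
    field_simp
  have h := HasSum.even_add_odd (f := fun n : ℕ => ((n.factorial : ℂ)⁻¹) • M ^ n) hc hs
  exact (congrFun (NormedSpace.exp_eq_tsum ℂ) M).trans h.tsum_eq

open Complex in
theorem expPauli_eq (a b c r : ℝ) (hr : r ^ 2 = a ^ 2 + b ^ 2 + c ^ 2) :
    expPauli a b c =
      !![Real.cos r - Real.sinc r * c * I, -I * (Real.sinc r * (a - b * I));
        -I * (Real.sinc r * (a + b * I)), Real.cos r + Real.sinc r * c * I] := by
  rw [expPauli, exp_of_sq_eq_neg_sq _ r (by rw [pauliCombination_sq, hr])]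
  · ext i j
    fin_cases i <;> fin_cases j <;> simp [pauliX, pauliY, pauliZ] <;> ring
  · rintro rfl
    have ha : a = 0 := by nlinarith
    have hb : b = 0 := by nlinarith
    have hc : c = 0 := by nlinarith
    simp [ha, hb, hc]

theorem sinc_pos_of_abs_lt_pi {r : ℝ} (h0 : 0 ≤ r) (hr : r < Real.pi) : 0 < Real.sinc r := by
  rcases h0.eq_or_lt with rfl | h
  · simp
  · rw [Real.sinc_of_ne_zero h.ne']
    exact div_pos (Real.sin_pos_of_pos_of_lt_pi h hr) h

open Complex ComplexConjugate in
/-- Every special unitary matrix other than `-1` has a generator in the principal range. -/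
theorem exists_expPauli_eq (u v : ℂ) (h : u * conj u + v * conj v = 1) (hu : -1 < u.re) :
    ∃ a b c : ℝ, a ^ 2 + b ^ 2 + c ^ 2 < Real.pi ^ 2 ∧
      !![u, -conj v; v, conj u] = expPauli a b c := by
  have hn : u.re ^ 2 + u.im ^ 2 + (v.re ^ 2 + v.im ^ 2) = 1 := by
    have := congrArg Complex.re h
    simp at this
    linarith
  -- The trace of the matrix is 2 Re u, and that of the exponential is 2 cos r.
  set r := Real.arccos u.re with hrdef
  have hcos : Real.cos r = u.re := Real.cos_arccos hu.le (by nlinarith)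
  have hr0 : 0 ≤ r := Real.arccos_nonneg _
  have hrpi : r < Real.pi := by
    refine lt_of_le_of_ne (Real.arccos_le_pi _) fun h => ?_
    rw [h, Real.cos_pi] at hcos
    linarith
  have hs := sinc_pos_of_abs_lt_pi hr0 hrpi
  have hsin : (Real.sinc r * r) ^ 2 = 1 - u.re ^ 2 := by
    have : Real.sinc r * r = Real.sin r := by
      by_cases h : r = 0
      · simp [h]
      · rw [Real.sinc_of_ne_zero h]; field_simp
    rw [this, ← hcos]
    linarith [Real.sin_sq_add_cos_sq r]
  have hr2 : r ^ 2 = (-v.im / Real.sinc r) ^ 2 + (v.re / Real.sinc r) ^ 2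
      + (-u.im / Real.sinc r) ^ 2 := by
    field_simp
    nlinarith
  refine ⟨-v.im / Real.sinc r, v.re / Real.sinc r, -u.im / Real.sinc r, ?_, ?_⟩
  · rw [← hr2]
    exact pow_lt_pow_left₀ hrpi hr0 two_ne_zero
  · rw [expPauli_eq _ _ _ r hr2, hcos]
    have hs' : (Real.sinc r : ℂ) ≠ 0 := by exact_mod_cast hs.ne'
    ext i j
    fin_cases i <;> fin_cases j <;> simp <;> field_simp <;>
      apply Complex.ext <;> simp

/-! ### The rotating system: conservation laws and symmetries -/

open Complex ComplexConjugate Set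

/-- The pair `(u, w)` solves `u' = -g e^{-iδ} w`, `w' = g e^{iδ} u` on `[a, b]`. -/
def IsRotation (g δ : ℝ → ℝ) (a b : ℝ) (u w : ℝ → ℂ) : Prop :=
  ∀ s ∈ Icc a b,
    HasDerivWithinAt u (-(g s * exp (-(δ s * I)) * w s)) (Icc a b) s ∧
    HasDerivWithinAt w (g s * exp (δ s * I) * u s) (Icc a b) s

theorem eq_of_hasDerivWithinAt_zero {a b : ℝ} {f : ℝ → ℂ}
    (hf : ∀ s ∈ Icc a b, HasDerivWithinAt f 0 (Icc a b) s) {s : ℝ} (hs : s ∈ Icc a b) :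
    f s = f a := by
  have := (convex_Icc a b).norm_image_sub_le_of_norm_hasDerivWithin_le (C := 0) hf (by simp)
    (left_mem_Icc.2 (hs.1.trans hs.2)) hs
  simpa [sub_eq_zero] using this

theorem conj_exp_mul_I (x : ℝ) : conj (exp (x * I)) = exp (-(x * I)) := by
  rw [← exp_conj]; simp

namespace IsRotation

variable {g δ : ℝ → ℝ} {a b : ℝ} {u w p q : ℝ → ℂ}

/-- The generator is traceless, so determinants are constant. Paired with `dual`, this yields
conservation of norm and inner product. -/
theorem wronskian (h : IsRotation g δ a b u w) (h' : IsRotation g δ a b p q) {s : ℝ}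
    (hs : s ∈ Icc a b) : u s * q s - w s * p s = u a * q a - w a * p a := by
  refine eq_of_hasDerivWithinAt_zero (f := fun s => u s * q s - w s * p s) (fun t ht => ?_) hs
  convert! ((h t ht).1.mul (h' t ht).2).sub ((h t ht).2.mul (h' t ht).1) using 1
  ring

theorem dual (h : IsRotation g δ a b u w) :
    IsRotation g δ a b (fun s => -conj (w s)) (fun s => conj (u s)) := by
  intro s hs
  have h1 := ((h s hs).1).star
  have h2 := ((h s hs).2).star
  constructor
  · convert! h2.neg using 1
    simp only [star_def, map_mul, conj_exp_mul_I, conj_ofReal]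
  · convert! h1 using 1
    simp only [star_def, map_mul, map_neg, ← conj_exp_mul_I, conj_ofReal, conj_conj]
    ring

theorem norm_conserved (h : IsRotation g δ a b u w) {s : ℝ} (hs : s ∈ Icc a b) :
    u s * conj (u s) + w s * conj (w s) = u a * conj (u a) + w a * conj (w a) := by
  have := h.wronskian h.dual hs
  linear_combination this

theorem inner_conserved (h : IsRotation g δ a b u w) (h' : IsRotation g δ a b p q) {s : ℝ}
    (hs : s ∈ Icc a b) :
    conj (u s) * p s + conj (w s) * q s = conj (u a) * p a + conj (w a) * q a := by
  have := h.dual.wronskian h' hs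
  linear_combination -this

theorem linear (h : IsRotation g δ a b u w) (h' : IsRotation g δ a b p q) (A B : ℂ) :
    IsRotation g δ a b (fun s => A * u s + B * p s) (fun s => A * w s + B * q s) := by
  intro s hs
  constructor
  · convert! ((h s hs).1.const_mul A).add ((h' s hs).1.const_mul B) using 1
    ring
  · convert! ((h s hs).2.const_mul A).add ((h' s hs).2.const_mul B) using 1
    ring

/-- Time reversal exchanges the components and negates the reversed phase. -/
theorem reverse {τ : ℝ} (h : IsRotation (fun _ => τ) δ 0 1 u w) :
    IsRotation (fun _ => τ) (fun s => -δ (1 - s)) 0 1 (fun s => w (1 - s)) (fun s => u (1 - s)) := by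
  intro s hs
  have hs' : 1 - s ∈ Icc (0 : ℝ) 1 := ⟨by linarith [hs.2], by linarith [hs.1]⟩
  have hr : HasDerivWithinAt (fun s : ℝ => 1 - s) (-1) (Icc 0 1) s :=
    ((hasDerivAt_id s).const_sub 1).hasDerivWithinAt
  have hm : MapsTo (fun s : ℝ => 1 - s) (Icc 0 1) (Icc 0 1) := fun x hx =>
    ⟨by linarith [hx.2], by linarith [hx.1]⟩
  constructor
  · convert! HasDerivWithinAt.scomp s (h _ hs').2 hr hm using 1
    simp
  · convert! HasDerivWithinAt.scomp s (h _ hs').1 hr hm using 1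
    simp

theorem unit_norm (h : IsRotation g δ a b u w) (hu : u a = 1) (hw : w a = 0) {s : ℝ}
    (hs : s ∈ Icc a b) : ‖u s‖ ^ 2 + ‖w s‖ ^ 2 = 1 := by
  have := h.norm_conserved hs
  rw [hu, hw, mul_conj', mul_conj'] at this
  simp at this
  exact_mod_cast this

theorem norm_fst_le (h : IsRotation g δ a b u w) (hu : u a = 1) (hw : w a = 0) {s : ℝ}
    (hs : s ∈ Icc a b) : ‖u s‖ ≤ 1 := by
  nlinarith [h.unit_norm hu hw hs, norm_nonneg (u s), sq_nonneg ‖w s‖]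

theorem norm_snd_le (h : IsRotation g δ a b u w) (hu : u a = 1) (hw : w a = 0) {s : ℝ}
    (hs : s ∈ Icc a b) : ‖w s‖ ≤ 1 := by
  nlinarith [h.unit_norm hu hw hs, norm_nonneg (w s), sq_nonneg ‖u s‖]

/-- The solution started at `(1, 0)` with the phase `-δ (1 - s)` ends at `conj (w 1)`. -/
theorem exists_reversed {τ : ℝ} (h : IsRotation (fun _ => τ) δ 0 1 u w) (hu : u 0 = 1)
    (hw : w 0 = 0) :
    ∃ p q, IsRotation (fun _ => τ) (fun s => -δ (1 - s)) 0 1 p q ∧ p 0 = 1 ∧ q 0 = 0 ∧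
      q 1 = conj (w 1) := by
  have hn := h.norm_conserved (right_mem_Icc.2 zero_le_one)
  simp only [hu, hw, map_one, map_zero, mul_one, mul_zero, add_zero] at hn
  have hd := h.dual.reverse
  -- The reversed solution and its reversed dual form a basis; these coefficients are the ones that
  -- produce the initial value (1, 0).
  refine ⟨_, _, h.reverse.linear hd (conj (w 1)) (u 1), ?_, ?_, ?_⟩
  · simp; linear_combination hn
  · simp; ring
  · simp [hu, hw]

/-! ### Growth and perturbation bounds -/

variable {τ : ℝ}

theorem norm_snd_le_mul (h : IsRotation (fun _ => τ) δ 0 1 u w) (hτ : 0 ≤ τ) (hu : u 0 = 1)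
    (hw : w 0 = 0) {s : ℝ} (hs : s ∈ Icc (0 : ℝ) 1) : ‖w s‖ ≤ τ := by
  have := (convex_Icc (0 : ℝ) 1).norm_image_sub_le_of_norm_hasDerivWithin_le (C := τ)
    (fun s hs => (h s hs).2) (fun s hs => by
      rw [norm_mul, norm_mul, norm_exp_ofReal_mul_I, norm_real, Real.norm_of_nonneg hτ]
      nlinarith [h.norm_fst_le hu hw hs]) (left_mem_Icc.2 zero_le_one) hs
  rw [hw, sub_zero, sub_zero, Real.norm_of_nonneg hs.1] at this
  nlinarith [hs.2]

theorem norm_exp_neg_ofReal_mul_I (x : ℝ) : ‖exp (-(x * I))‖ = 1 := by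
  rw [← conj_exp_mul_I, RCLike.norm_conj, norm_exp_ofReal_mul_I]

theorem norm_fst_sub_one_le (h : IsRotation (fun _ => τ) δ 0 1 u w) (hτ : 0 ≤ τ) (hu : u 0 = 1)
    (hw : w 0 = 0) {s : ℝ} (hs : s ∈ Icc (0 : ℝ) 1) : ‖u s - 1‖ ≤ τ ^ 2 := by
  have := (convex_Icc (0 : ℝ) 1).norm_image_sub_le_of_norm_hasDerivWithin_le (C := τ ^ 2)
    (fun s hs => (h s hs).1) (fun s hs => by
      rw [norm_neg, norm_mul, norm_mul, norm_exp_neg_ofReal_mul_I, norm_real,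
        Real.norm_of_nonneg hτ]
      nlinarith [h.norm_snd_le_mul hτ hu hw hs]) (left_mem_Icc.2 zero_le_one) hs
  rw [hu, sub_zero, Real.norm_of_nonneg hs.1] at this
  nlinarith [hs.2, sq_nonneg τ]

/-- Two solutions stay close when their phase factors do. -/
theorem norm_sub_le {δ' : ℝ → ℝ} (h : IsRotation (fun _ => τ) δ 0 1 u w)
    (h' : IsRotation (fun _ => τ) δ' 0 1 p q) (hτ : 0 < τ) (hup : u 0 = p 0) (hwq : w 0 = q 0)
    (hp : p 0 = 1) (hq : q 0 = 0) {E : ℝ}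
    (hE : ∀ s ∈ Icc (0 : ℝ) 1, ‖exp (δ s * I) - exp (δ' s * I)‖ ≤ E) {s : ℝ}
    (hs : s ∈ Icc (0 : ℝ) 1) :
    ‖u s - p s‖ ≤ E * (τ * Real.exp τ) ∧ ‖w s - q s‖ ≤ E * (τ * Real.exp τ) := by
  have hE0 : 0 ≤ E := (norm_nonneg _).trans (hE s hs)
  have hEn : ∀ s ∈ Icc (0 : ℝ) 1, ‖exp (-(δ s * I)) - exp (-(δ' s * I))‖ ≤ E := fun s hs => by
    rw [← conj_exp_mul_I, ← conj_exp_mul_I, ← map_sub, RCLike.norm_conj]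
    exact hE s hs
  have hd : ∀ s ∈ Icc (0 : ℝ) 1, HasDerivWithinAt (fun s => (u s - p s, w s - q s))
      (-(τ * exp (-(δ s * I)) * w s) - -(τ * exp (-(δ' s * I)) * q s),
        τ * exp (δ s * I) * u s - τ * exp (δ' s * I) * p s) (Icc 0 1) s := fun s hs =>
    ((h s hs).1.sub (h' s hs).1).prodMk ((h s hs).2.sub (h' s hs).2)
  -- In the sup norm the difference has growth rate τ and forcing at most τE, because the second
  -- solution has components of size at most 1.
  have key := norm_le_gronwallBound_of_norm_deriv_right_le (δ := 0) (K := τ) (ε := τ * E)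
    (fun s hs => (hd s hs).continuousWithinAt)
    (fun s hs => (hd s (Ico_subset_Icc_self hs)).mono_of_mem_nhdsWithin
      (Icc_mem_nhdsGE_of_mem hs)) (by simp [hup, hwq]) (fun s hs => ?_) s hs
  · have hb : gronwallBound 0 τ (τ * E) (s - 0) ≤ E * (τ * Real.exp τ) := by
      rw [gronwallBound_of_K_ne_0 hτ.ne']
      have h1 : Real.exp (τ * s) ≤ Real.exp τ := Real.exp_le_exp.2 (by nlinarith [hs.2])
      have h2 : Real.exp τ - 1 ≤ τ * Real.exp τ := by
        have := Real.add_one_le_exp (-τ)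
        have h3 : Real.exp (-τ) * Real.exp τ = 1 := by rw [← Real.exp_add]; simp
        nlinarith [Real.exp_pos τ]
      have : τ * E / τ = E := by field_simp
      simp only [zero_mul, zero_add, sub_zero, this]
      gcongr
      linarith
    exact ⟨(_root_.norm_fst_le _).trans (key.trans hb), (_root_.norm_snd_le _).trans (key.trans hb)⟩
  · have hs := Ico_subset_Icc_self hs
    have hu1 : ‖p s‖ ≤ 1 := h'.norm_fst_le hp hq hs
    have hw1 : ‖q s‖ ≤ 1 := h'.norm_snd_le hp hq hs
    refine max_le ?_ ?_
    · rw [show -((τ : ℂ) * exp (-(δ s * I)) * w s) - -(τ * exp (-(δ' s * I)) * q s) =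
        -(τ * (exp (-(δ s * I)) * (w s - q s) +
          (exp (-(δ s * I)) - exp (-(δ' s * I))) * q s)) by ring, norm_neg, norm_mul, norm_real,
        Real.norm_of_nonneg hτ.le, ← mul_add]
      gcongr
      refine (norm_add_le _ _).trans ?_
      rw [norm_mul, norm_mul, norm_exp_neg_ofReal_mul_I, one_mul]
      refine add_le_add (_root_.norm_snd_le (u s - p s, w s - q s)) ?_
      nlinarith [hEn s hs, norm_nonneg (q s)]
    · rw [show (τ : ℂ) * exp (δ s * I) * u s - τ * exp (δ' s * I) * p s =
        τ * (exp (δ s * I) * (u s - p s) + (exp (δ s * I) - exp (δ' s * I)) * p s) by ring,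
        norm_mul, norm_real, Real.norm_of_nonneg hτ.le, ← mul_add]
      gcongr
      refine (norm_add_le _ _).trans ?_
      rw [norm_mul, norm_mul, norm_exp_ofReal_mul_I, one_mul]
      refine add_le_add (_root_.norm_fst_le (u s - p s, w s - q s)) ?_
      nlinarith [hE s hs, norm_nonneg (p s)]

/-- The first components of two solutions are closer by a further factor `τ`. -/
theorem norm_fst_sub_le {δ' : ℝ → ℝ} (h : IsRotation (fun _ => τ) δ 0 1 u w)
    (h' : IsRotation (fun _ => τ) δ' 0 1 p q) (hτ : 0 < τ) (hup : u 0 = p 0) (hwq : w 0 = q 0)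
    (hp : p 0 = 1) (hq : q 0 = 0) {E : ℝ}
    (hE : ∀ s ∈ Icc (0 : ℝ) 1, ‖exp (δ s * I) - exp (δ' s * I)‖ ≤ E) {s : ℝ}
    (hs : s ∈ Icc (0 : ℝ) 1) : ‖u s - p s‖ ≤ 2 * E * τ ^ 2 * Real.exp τ := by
  have hE0 : 0 ≤ E := (norm_nonneg _).trans (hE s hs)
  have h1 : 1 ≤ Real.exp τ := Real.one_le_exp hτ.le
  have := (convex_Icc (0 : ℝ) 1).norm_image_sub_le_of_norm_hasDerivWithin_le
    (C := 2 * E * τ ^ 2 * Real.exp τ)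
    (fun s hs => (h s hs).1.sub (h' s hs).1) (fun s hs => ?_) (left_mem_Icc.2 zero_le_one) hs
  · simp only [Pi.sub_apply, hup, sub_self, sub_zero, Real.norm_of_nonneg hs.1] at this
    refine this.trans (mul_le_of_le_one_right (by positivity) hs.2)
  · rw [show -((τ : ℂ) * exp (-(δ s * I)) * w s) - -(τ * exp (-(δ' s * I)) * q s) =
        -(τ * (exp (-(δ s * I)) * (w s - q s) +
          (exp (-(δ s * I)) - exp (-(δ' s * I))) * q s)) by ring, norm_neg, norm_mul, norm_real,
        Real.norm_of_nonneg hτ.le]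
    -- The extra factor τ comes from `q`, which is O(τ), and from the difference of second
    -- components, which is O(Eτ).
    have h2 : ‖exp (-(δ s * I)) * (w s - q s) +
          (exp (-(δ s * I)) - exp (-(δ' s * I))) * q s‖ ≤ E * (τ * Real.exp τ) + E * τ := by
      refine (norm_add_le _ _).trans ?_
      rw [norm_mul, norm_mul, norm_exp_neg_ofReal_mul_I, one_mul]
      refine add_le_add (h.norm_sub_le h' hτ hup hwq hp hq hE hs).2 ?_
      rw [← conj_exp_mul_I, ← conj_exp_mul_I, ← map_sub, RCLike.norm_conj]
      exact mul_le_mul (hE s hs) (h'.norm_snd_le_mul hτ.le hp hq hs) (norm_nonneg _) hE0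
    calc τ * _ ≤ τ * (E * (τ * Real.exp τ) + E * (τ * Real.exp τ)) := by
          refine mul_le_mul_of_nonneg_left (h2.trans ?_) hτ.le
          gcongr
          exact le_mul_of_one_le_right hτ.le h1
      _ = _ := by ring

end IsRotation

/-- Bounding each sine separately would give only D³. Writing the sum as 2 sin e cos o, with
half-sum e and half-difference o, keeps the small factor x + y. -/
theorem abs_sin_add_sin_sub_le {x y D E : ℝ} (hx : |x| ≤ D) (hy : |y| ≤ D) (hD : D ≤ 1)
    (hE : |x + y| ≤ E) : |Real.sin x + Real.sin y - (x + y)| ≤ 2 * E * D ^ 2 := by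
  have hE0 : 0 ≤ E := (abs_nonneg _).trans hE
  set e := (x + y) / 2 with he
  set o := (x - y) / 2 with ho
  have heE : |e| ≤ E / 2 := by rw [he, abs_div, abs_two]; linarith
  have heD : |e| ≤ D := by rw [he]; rw [abs_le] at *; constructor <;> linarith
  have hoD : |o| ≤ D := by rw [ho]; rw [abs_le] at *; constructor <;> linarith
  have hD0 : 0 ≤ D := (abs_nonneg _).trans hx
  have h1 : |Real.sin e - e| ≤ E / 2 * D ^ 2 := by
    have h := Real.sin_bound (heD.trans hD)
    have h2 : |Real.sin e - e| ≤ |e| ^ 5 / 100 + |e| ^ 3 / 6 := by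
      calc |Real.sin e - e| = |(Real.sin e - (e - e ^ 3 / 6)) + -(e ^ 3 / 6)| := by ring_nf
        _ ≤ |Real.sin e - (e - e ^ 3 / 6)| + |-(e ^ 3 / 6)| := abs_add_le _ _
        _ ≤ _ := by
          rw [abs_neg, abs_div, abs_pow, abs_of_pos (by norm_num : (0 : ℝ) < 6)]
          gcongr
    have h3 : |e| ^ 2 ≤ D ^ 2 := by gcongr
    have h4 : |e| ^ 3 ≤ E / 2 * D ^ 2 := by
      calc |e| ^ 3 = |e| * |e| ^ 2 := by ring
        _ ≤ _ := by gcongr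
    have h5 : |e| ^ 5 ≤ |e| ^ 3 :=
      pow_le_pow_of_le_one (abs_nonneg _) (heD.trans hD) (by norm_num)
    have : 0 ≤ |e| ^ 3 := by positivity
    linarith
  have h2 : |Real.cos o - 1| ≤ D ^ 2 / 2 := by
    have h3 := Real.one_sub_sq_div_two_le_cos (x := o)
    have h4 : o ^ 2 ≤ D ^ 2 := by rw [← sq_abs o]; gcongr
    rw [abs_le]
    constructor <;> nlinarith [Real.cos_le_one o]
  have h3 : Real.sin x + Real.sin y - (x + y)
      = 2 * ((Real.sin e - e) * Real.cos o + e * (Real.cos o - 1)) := by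
    rw [Real.sin_add_sin, ← he, ← ho]; rw [show x + y = 2 * e by rw [he]; ring]; ring
  rw [h3, abs_mul, abs_two]
  have h4 : |(Real.sin e - e) * Real.cos o| ≤ E / 2 * D ^ 2 := by
    rw [abs_mul]
    exact (mul_le_mul h1 (Real.abs_cos_le_one o) (abs_nonneg _) (by positivity)).trans_eq
      (mul_one _)
  have h5 : |e * (Real.cos o - 1)| ≤ E / 2 * (D ^ 2 / 2) := by
    rw [abs_mul]; gcongr
  have h6 := abs_add_le ((Real.sin e - e) * Real.cos o) (e * (Real.cos o - 1))
  have : 0 ≤ E * D ^ 2 := by positivity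
  linarith

theorem norm_exp_sub_exp_le (x y : ℝ) : ‖exp (x * I) - exp (y * I)‖ ≤ |x - y| := by
  have h : exp (x * I) - exp (y * I) = exp (y * I) * (exp (I * ((x - y : ℝ) : ℂ)) - 1) := by
    rw [mul_sub, ← exp_add, mul_one]
    congr 2
    push_cast
    ring
  rw [h, norm_mul, norm_exp_ofReal_mul_I, one_mul]
  exact Real.norm_exp_I_mul_ofReal_sub_one_le

theorem mul_sin_le_sin {τ Θ : ℝ} (h0 : 0 ≤ τ) (hτ : τ ≤ Θ) (hΘ0 : 0 < Θ) (hΘ : Θ < Real.pi) :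
    τ * (Real.sin Θ / Θ) ≤ Real.sin τ := by
  have ha : 0 ≤ 1 - τ / Θ := by rw [sub_nonneg, div_le_one hΘ0]; exact hτ
  have := strictConcaveOn_sin_Icc.concaveOn.2 (left_mem_Icc.2 Real.pi_pos.le)
    (show Θ ∈ Icc 0 Real.pi from ⟨hΘ0.le, hΘ.le⟩) ha
    (show 0 ≤ τ / Θ by positivity) (by ring)
  simp only [Real.sin_zero, smul_eq_mul, mul_zero, zero_add, div_mul_cancel₀ _ hΘ0.ne'] at this
  linarith [show τ / Θ * Real.sin Θ = τ * (Real.sin Θ / Θ) by ring]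

/-! ### The argument of the final value of w -/

namespace IsRotation

variable {τ : ℝ} {δ : ℝ → ℝ} {u w : ℝ → ℂ}

/-- The reversed problem ends at conj (w 1), so 2 Im w(1) is the imaginary part of a difference of
two solutions. Replacing both first components by 1 in its derivative gives the integral; the error
has the factor E from the phases and τ³ from `u - 1` and `u - p`. -/
theorem abs_im_sub_integral_le (h : IsRotation (fun _ => τ) δ 0 1 u w) (hτ : 0 < τ)
    (hu : u 0 = 1) (hw : w 0 = 0) (hδ : Continuous δ) {E : ℝ}
    (hE : ∀ s ∈ Icc (0 : ℝ) 1, |δ s + δ (1 - s)| ≤ E) :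
    |2 * (w 1).im - τ * ∫ s in (0 : ℝ)..1, (Real.sin (δ s) + Real.sin (δ (1 - s)))| ≤
      τ ^ 3 * E * (1 + 2 * Real.exp τ) := by
  obtain ⟨p, q, hpq, hp, hq, hq1⟩ := h.exists_reversed hu hw
  have hE0 : 0 ≤ E := (abs_nonneg _).trans (hE 0 ⟨le_rfl, zero_le_one⟩)
  have hEe : ∀ s ∈ Icc (0 : ℝ) 1, ‖exp (δ s * I) - exp ((-δ (1 - s) : ℝ) * I)‖ ≤ E :=
    fun s hs => (norm_exp_sub_exp_le _ _).trans (by simpa using hE s hs)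
  set G : ℝ → ℝ := fun s => Real.sin (δ s) + Real.sin (δ (1 - s)) with hG
  have hGc : Continuous G := by fun_prop
  have hd : ∀ s ∈ Icc (0 : ℝ) 1, HasDerivWithinAt
      (fun s => (w s - q s).im - τ * ∫ r in (0 : ℝ)..s, G r)
      ((τ * exp (δ s * I) * u s - τ * exp ((-δ (1 - s) : ℝ) * I) * p s).im - τ * G s)
      (Icc 0 1) s := fun s hs => by
    have h1 := ((h s hs).2.sub (hpq s hs).2)
    have h2 := imCLM.hasFDerivAt.comp_hasDerivWithinAt s h1
    have h3 := (intervalIntegral.integral_hasDerivAt_right (hGc.intervalIntegrable 0 s)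
      hGc.stronglyMeasurable.stronglyMeasurableAtFilter hGc.continuousAt).hasDerivWithinAt
      (s := Icc (0 : ℝ) 1)
    exact h2.sub (h3.const_mul τ)
  have hb : ∀ s ∈ Icc (0 : ℝ) 1,
      ‖(τ * exp (δ s * I) * u s - τ * exp ((-δ (1 - s) : ℝ) * I) * p s).im - τ * G s‖ ≤
        τ ^ 3 * E * (1 + 2 * Real.exp τ) := fun s hs => by
    have h1 : (τ * exp (δ s * I) * u s - τ * exp ((-δ (1 - s) : ℝ) * I) * p s).im - τ * G s =
        (τ * ((exp (δ s * I) - exp ((-δ (1 - s) : ℝ) * I)) * (u s - 1) +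
          exp ((-δ (1 - s) : ℝ) * I) * (u s - p s)) : ℂ).im := by
      have h2 : (((τ * G s : ℝ) : ℂ)) = τ * G s := by push_cast; ring
      have h3 : τ * G s =
          (τ * (exp (δ s * I) - exp ((-δ (1 - s) : ℝ) * I)) : ℂ).im := by
        rw [im_ofReal_mul, sub_im, exp_ofReal_mul_I_im, exp_ofReal_mul_I_im, Real.sin_neg]
        simp [hG]
      rw [h3, ← sub_im]
      congr 1
      ring
    rw [h1]
    refine (abs_im_le_norm _).trans ?_
    rw [norm_mul, norm_real, Real.norm_of_nonneg hτ.le]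
    have h4 : ‖(exp (δ s * I) - exp ((-δ (1 - s) : ℝ) * I)) * (u s - 1) +
          exp ((-δ (1 - s) : ℝ) * I) * (u s - p s)‖ ≤
          E * τ ^ 2 + 2 * E * τ ^ 2 * Real.exp τ := by
      refine (norm_add_le _ _).trans ?_
      rw [norm_mul, norm_mul, norm_exp_ofReal_mul_I, one_mul]
      refine add_le_add ?_ ?_
      · exact mul_le_mul (hEe s hs) (h.norm_fst_sub_one_le hτ.le hu hw hs) (norm_nonneg _) hE0
      · exact h.norm_fst_sub_le hpq hτ (hu.trans hp.symm) (hw.trans hq.symm) hp hq hEe hs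
    calc τ * _ ≤ τ * (E * τ ^ 2 + 2 * E * τ ^ 2 * Real.exp τ) := by gcongr
      _ = _ := by ring
  have := (convex_Icc (0 : ℝ) 1).norm_image_sub_le_of_norm_hasDerivWithin_le hd hb
    (left_mem_Icc.2 zero_le_one) (right_mem_Icc.2 zero_le_one)
  simp only [hw, hq, hq1, sub_self, zero_im, intervalIntegral.integral_same, mul_zero, sub_zero,
    sub_im, conj_im, norm_one, mul_one, Real.norm_eq_abs, sub_neg_eq_add] at this
  rwa [← two_mul] at this

theorem abs_im_le (h : IsRotation (fun _ => τ) δ 0 1 u w) (hτ : 0 < τ)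
    (hu : u 0 = 1) (hw : w 0 = 0) (hδ : Continuous δ) {D E : ℝ} (hD1 : D ≤ 1)
    (hD : ∀ s ∈ Icc (0 : ℝ) 1, |δ s| ≤ D) (hE : ∀ s ∈ Icc (0 : ℝ) 1, |δ s + δ (1 - s)| ≤ E)
    (hmean : ∫ s in (0 : ℝ)..1, δ s = 0) :
    |(w 1).im| ≤ τ * E * (D ^ 2 + 2 * τ ^ 2 * Real.exp τ) := by
  have hE0 : 0 ≤ E := (abs_nonneg _).trans (hE 0 ⟨le_rfl, zero_le_one⟩)
  have h1 := h.abs_im_sub_integral_le hτ hu hw hδ hE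
  have hmean' : ∫ s in (0 : ℝ)..1, δ (1 - s) = 0 := by
    rw [intervalIntegral.integral_comp_sub_left (fun s => δ s) 1]
    simpa using hmean
  have hi1 : IntervalIntegrable δ MeasureTheory.volume 0 1 := hδ.intervalIntegrable _ _
  have hi2 : IntervalIntegrable (fun s => δ (1 - s)) MeasureTheory.volume 0 1 :=
    (hδ.comp (by fun_prop : Continuous fun s : ℝ => 1 - s)).intervalIntegrable _ _
  have hi3 : IntervalIntegrable (fun s => Real.sin (δ s) + Real.sin (δ (1 - s)))
      MeasureTheory.volume 0 1 :=
    (by fun_prop : Continuous fun s => Real.sin (δ s) + Real.sin (δ (1 - s))).intervalIntegrable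
      _ _
  have h2 : |∫ s in (0 : ℝ)..1, (Real.sin (δ s) + Real.sin (δ (1 - s)))| ≤ 2 * E * D ^ 2 := by
    -- The zero mean allows the linear part to be subtracted for free.
    have h3 : ∫ s in (0 : ℝ)..1, (Real.sin (δ s) + Real.sin (δ (1 - s))) =
        ∫ s in (0 : ℝ)..1, (Real.sin (δ s) + Real.sin (δ (1 - s)) - (δ s + δ (1 - s))) := by
      rw [intervalIntegral.integral_sub hi3 (hi1.add hi2), intervalIntegral.integral_add hi1 hi2,
        hmean, hmean']
      simp
    rw [h3]
    have := intervalIntegral.norm_integral_le_of_norm_le_const (a := 0) (b := 1)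
      (C := 2 * E * D ^ 2)
      (f := fun s => Real.sin (δ s) + Real.sin (δ (1 - s)) - (δ s + δ (1 - s))) (fun s hs => by
        rw [uIoc_of_le zero_le_one] at hs
        have hs := Ioc_subset_Icc_self hs
        exact abs_sin_add_sin_sub_le (hD s hs)
          (hD _ ⟨by linarith [hs.2], by linarith [hs.1]⟩) hD1 (hE s hs))
    simpa using this
  have hM : 1 ≤ Real.exp τ := Real.one_le_exp hτ.le
  have h4 : |2 * (w 1).im| ≤ τ * (2 * E * D ^ 2) + τ ^ 3 * E * (1 + 2 * Real.exp τ) := by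
    set J := ∫ s in (0 : ℝ)..1, (Real.sin (δ s) + Real.sin (δ (1 - s)))
    calc |2 * (w 1).im| = |τ * J + (2 * (w 1).im - τ * J)| := by ring_nf
      _ ≤ |τ * J| + |2 * (w 1).im - τ * J| := abs_add_le _ _
      _ ≤ _ := by
        rw [abs_mul, abs_of_pos hτ]
        gcongr
  rw [abs_mul, abs_two] at h4
  have : 0 ≤ τ ^ 3 * E * (2 * Real.exp τ - 1) :=
    mul_nonneg (by positivity) (by linarith)
  linarith [show τ * E * (D ^ 2 + 2 * τ ^ 2 * Real.exp τ) * 2 =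
    τ * (2 * E * D ^ 2) + τ ^ 3 * E * (1 + 2 * Real.exp τ) +
      τ ^ 3 * E * (2 * Real.exp τ - 1) by ring]

theorem const_phase (τ : ℝ) : IsRotation (fun _ => τ) (fun _ => 0) 0 1
    (fun s => (Real.cos (τ * s) : ℂ)) (fun s => (Real.sin (τ * s) : ℂ)) := by
  intro s _
  have h1 : HasDerivAt (fun s : ℝ => τ * s) τ s := by
    simpa using (hasDerivAt_id s).const_mul τ
  constructor
  · convert! h1.cos.ofReal_comp.hasDerivWithinAt using 1
    simp; ring
  · convert! h1.sin.ofReal_comp.hasDerivWithinAt using 1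
    simp; ring

theorem le_re (h : IsRotation (fun _ => τ) δ 0 1 u w) (hτ : 0 < τ)
    (hu : u 0 = 1) (hw : w 0 = 0) {D : ℝ} (hD : ∀ s ∈ Icc (0 : ℝ) 1, |δ s| ≤ D) :
    Real.sin τ - D * (τ * Real.exp τ) ≤ (w 1).re := by
  have h1 := (h.norm_sub_le (const_phase τ) hτ (by simp [hu]) (by simp [hw]) (by simp) (by simp)
    (E := D) (fun s hs => (norm_exp_sub_exp_le _ _).trans (by simpa using hD s hs))
    (right_mem_Icc.2 zero_le_one)).2
  have h2 := (abs_le.1 ((abs_re_le_norm _).trans h1)).1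
  rw [sub_re, ofReal_re, mul_one] at h2
  linarith

/-- On the unit sphere the first component moves away from 1 with angular speed at most τ, so it
cannot reach the antipode in unit time. -/
theorem neg_one_lt_re (h : IsRotation (fun _ => τ) δ 0 1 u w) (hτ : 0 < τ) (hτπ : τ < Real.pi)
    (hu : u 0 = 1) (hw : w 0 = 0) : -1 < (u 1).re := by
  -- The barrier angle ε + (τ + ε)s runs from ε to π - ε. The head start keeps its sine positive,
  -- and the extra speed makes the comparison of derivatives strict.
  set ε := (Real.pi - τ) / 3 with hε
  have hε0 : 0 < ε := by rw [hε]; linarith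
  have hd : ∀ s ∈ Icc (0 : ℝ) 1, HasDerivWithinAt (fun s => -(u s).re)
      (-(-(τ * exp (-(δ s * I)) * w s)).re) (Icc 0 1) s := fun s hs =>
    (reCLM.hasFDerivAt.comp_hasDerivWithinAt s (h s hs).1).neg
  have hB : ∀ s : ℝ, HasDerivAt (fun s => -Real.cos (ε + (τ + ε) * s))
      ((τ + ε) * Real.sin (ε + (τ + ε) * s)) s := fun s => by
    have h1 : HasDerivAt (fun s : ℝ => ε + (τ + ε) * s) (τ + ε) s := by
      simpa using ((hasDerivAt_id s).const_mul (τ + ε)).const_add ε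
    convert! h1.cos.neg using 1
    ring
  have key := image_le_of_deriv_right_lt_deriv_boundary (f := fun s => -(u s).re)
    (f' := fun s => -(-(τ * exp (-(δ s * I)) * w s)).re)
    (fun s hs => (hd s hs).continuousWithinAt)
    (fun s hs => (hd s (Ico_subset_Icc_self hs)).mono_of_mem_nhdsWithin
      (Icc_mem_nhdsGE_of_mem hs)) (by simp [hu, Real.cos_le_one]) hB
    (fun s hs hfB => ?_) (right_mem_Icc.2 (zero_le_one' ℝ))
  · have h1 : Real.cos Real.pi < Real.cos (ε + (τ + ε) * 1) :=
      Real.cos_lt_cos_of_nonneg_of_le_pi (by nlinarith) le_rfl (by rw [hε]; linarith)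
    rw [Real.cos_pi] at h1
    linarith
  · have hs' := Ico_subset_Icc_self hs
    have hsin : 0 < Real.sin (ε + (τ + ε) * s) :=
      Real.sin_pos_of_pos_of_lt_pi (by nlinarith [hs'.1]) (by nlinarith [hs.2])
    have hn := h.unit_norm hu hw hs'
    have hw1 : ‖w s‖ ≤ Real.sin (ε + (τ + ε) * s) := by
      have h2 : (u s).re = Real.cos (ε + (τ + ε) * s) := by linarith
      have h3 : (u s).re ^ 2 ≤ ‖u s‖ ^ 2 := by
        rw [← sq_abs]; gcongr; exact abs_re_le_norm _
      refine abs_le_of_sq_le_sq' (a := ‖w s‖) ?_ hsin.le |>.2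
      rw [h2] at h3
      linarith [Real.sin_sq_add_cos_sq (ε + (τ + ε) * s)]
    calc -(-(τ * exp (-(δ s * I)) * w s)).re ≤ ‖-(τ * exp (-(δ s * I)) * w s)‖ :=
          (neg_le_abs _).trans (abs_re_le_norm _)
      _ = τ * ‖w s‖ := by
        rw [norm_neg, norm_mul, norm_mul, norm_exp_neg_ofReal_mul_I, norm_real,
          Real.norm_of_nonneg hτ.le, mul_one]
      _ ≤ τ * Real.sin (ε + (τ + ε) * s) := by gcongr
      _ < _ := by nlinarith

/-- If the phase is small, centred, and nearly odd about the midpoint, then the direction of the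
final value of `w` is determined to fourth order. -/
theorem exists_polar {C Θ : ℝ} (hC : 0 ≤ C) (hΘ0 : 0 < Θ) (hΘ : Θ < Real.pi) :
    ∃ K : ℝ, 0 < K ∧ ∃ ε : ℝ, 0 < ε ∧ ∀ {τ b : ℝ} {δ : ℝ → ℝ} {u w : ℝ → ℂ},
      0 < τ → τ ≤ Θ → 0 < b → b ≤ ε →
      IsRotation (fun _ => τ) δ 0 1 u w → u 0 = 1 → w 0 = 0 → Continuous δ →
      (∀ s ∈ Icc (0 : ℝ) 1, |δ s| ≤ C * b) →
      (∀ s ∈ Icc (0 : ℝ) 1, |δ s + δ (1 - s)| ≤ C * b ^ 2) →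
      ∫ s in (0 : ℝ)..1, δ s = 0 →
      ∃ ρ : ℝ, 0 < ρ ∧ ∃ η : ℝ, w 1 = (ρ : ℂ) * exp (η * I) ∧
        |η| ≤ K * ((b ^ 2 + τ ^ 2) * b ^ 2) := by
  set c := Real.sin Θ / Θ with hc
  have hc0 : 0 < c := div_pos (Real.sin_pos_of_pos_of_lt_pi hΘ0 hΘ) hΘ0
  set M := Real.exp Θ with hM
  have hM0 : 0 < M := Real.exp_pos _
  have hpi := Real.pi_pos
  -- The two thresholds give Cb ≤ 1 and CbM ≤ c/2; the latter leaves Re w(1) ≥ τc/2. In K, the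
  -- factor π/c is π/2 from Jordan's inequality times 2/c from this lower bound; the 1 covers C = 0.
  refine ⟨Real.pi / c * (C * (C ^ 2 + 2 * M)) + 1, by positivity,
    min (1 / (C + 1)) (c / (2 * (C * M + 1))), by positivity, ?_⟩
  intro τ b δ u w hτ hτΘ hb hbε h hu hw hδ hD hE hmean
  have hb1 : C * b ≤ 1 := by
    have := hbε.trans (min_le_left _ _)
    rw [le_div_iff₀ (by positivity)] at this
    nlinarith
  have hb2 : C * b * M ≤ c / 2 := by
    have := hbε.trans (min_le_right _ _)
    rw [le_div_iff₀ (by positivity)] at this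
    nlinarith
  have hexp : Real.exp τ ≤ M := Real.exp_le_exp.2 hτΘ
  have hre : τ * (c / 2) ≤ (w 1).re := by
    have h1 := h.le_re hτ hu hw hD
    have h2 := mul_sin_le_sin hτ.le hτΘ hΘ0 hΘ
    have h3 : C * b * (τ * Real.exp τ) ≤ C * b * (τ * M) := by gcongr
    have h4 : τ * (C * b * M) ≤ τ * (c / 2) := by gcongr
    rw [← hc] at h2
    nlinarith
  have hre0 : 0 < (w 1).re := lt_of_lt_of_le (by positivity) hre
  have him : |(w 1).im| ≤ τ * (C * (C ^ 2 + 2 * M) * ((b ^ 2 + τ ^ 2) * b ^ 2)) := by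
    refine (h.abs_im_le hτ hu hw hδ hb1 hD hE hmean).trans ?_
    calc τ * (C * b ^ 2) * ((C * b) ^ 2 + 2 * τ ^ 2 * Real.exp τ)
        ≤ τ * (C * b ^ 2) * ((C * b) ^ 2 + 2 * τ ^ 2 * M) := by gcongr
      _ ≤ τ * (C * b ^ 2) * ((C * b) ^ 2 + 2 * τ ^ 2 * M + (C ^ 2 * τ ^ 2 + 2 * M * b ^ 2)) := by
        exact mul_le_mul_of_nonneg_left (le_add_of_nonneg_right (by positivity)) (by positivity)
      _ = _ := by ring
  have hw1 : τ * (c / 2) ≤ ‖w 1‖ := hre.trans ((le_abs_self _).trans (abs_re_le_norm _))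
  have hw0 : 0 < ‖w 1‖ := lt_of_lt_of_le (by positivity) hw1
  refine ⟨‖w 1‖, hw0, arg (w 1), (norm_mul_exp_arg_mul_I _).symm, ?_⟩
  have h1 := Real.mul_abs_le_abs_sin (abs_arg_lt_pi_div_two_iff.2 (Or.inl hre0)).le
  rw [sin_arg, abs_div, abs_of_pos hw0] at h1
  set X := (b ^ 2 + τ ^ 2) * b ^ 2
  have hX : 0 ≤ X := by positivity
  have h2 : |(w 1).im| / ‖w 1‖ ≤ 2 / c * (C * (C ^ 2 + 2 * M) * X) := by
    rw [div_le_iff₀ hw0]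
    calc |(w 1).im| ≤ τ * (C * (C ^ 2 + 2 * M) * X) := him
      _ = 2 / c * (C * (C ^ 2 + 2 * M) * X) * (τ * (c / 2)) := by field_simp
      _ ≤ _ := by gcongr
  calc |arg (w 1)| = Real.pi / 2 * (2 / Real.pi * |arg (w 1)|) := by field_simp
    _ ≤ Real.pi / 2 * (2 / c * (C * (C ^ 2 + 2 * M) * X)) :=
        mul_le_mul_of_nonneg_left (h1.trans h2) (by positivity)
    _ = Real.pi / c * (C * (C ^ 2 + 2 * M)) * X := by field_simp
    _ ≤ _ := by gcongr; linarith

end IsRotation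

/-! ### Existence of the propagator -/

/-- A bounded nonlinear field on `ℂ²` that agrees with the identity on the unit sphere. -/
noncomputable def saturation (x : ℂ × ℂ) : ℂ × ℂ := (2 / (1 + ‖x.1‖ ^ 2 + ‖x.2‖ ^ 2)) • x

theorem saturation_den_pos (x : ℂ × ℂ) : 0 < 1 + ‖x.1‖ ^ 2 + ‖x.2‖ ^ 2 := by positivity

theorem contDiff_saturation : ContDiff ℝ 1 saturation := by
  unfold saturation
  refine ContDiff.smul (contDiff_const.div ?_ fun x => (saturation_den_pos x).ne') contDiff_id
  exact (contDiff_const.add (contDiff_fst.norm_sq ℝ)).add (contDiff_snd.norm_sq ℝ)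

theorem norm_saturation_le (x : ℂ × ℂ) : ‖saturation x‖ ≤ 1 := by
  have h := saturation_den_pos x
  rw [saturation, norm_smul, Real.norm_of_nonneg (by positivity), div_mul_eq_mul_div,
    div_le_one h, Prod.norm_def]
  rcases max_choice ‖x.1‖ ‖x.2‖ with h' | h' <;> rw [h'] <;>
    nlinarith [sq_nonneg (‖x.1‖ - 1), sq_nonneg (‖x.2‖ - 1), sq_nonneg ‖x.1‖, sq_nonneg ‖x.2‖]

/-- The rotating field with phase `x` applied to a vector. -/
noncomputable def rotField (ω x : ℝ) (v : ℂ × ℂ) : ℂ × ℂ :=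
  (-(ω * exp (-(x * I)) * v.2), ω * exp (x * I) * v.1)

theorem norm_rotField_sub (ω x : ℝ) (v v' : ℂ × ℂ) :
    ‖rotField ω x v - rotField ω x v'‖ = |ω| * ‖v - v'‖ := by
  have h1 : rotField ω x v - rotField ω x v' =
      (-(ω * exp (-(x * I)) * (v.2 - v'.2)), ω * exp (x * I) * (v.1 - v'.1)) := by
    simp only [rotField, Prod.mk_sub_mk]
    congr 1 <;> ring
  rw [h1, Prod.norm_mk, norm_neg, norm_mul, norm_mul, norm_mul, norm_mul,
    IsRotation.norm_exp_neg_ofReal_mul_I, norm_exp_ofReal_mul_I, norm_real, Real.norm_eq_abs,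
    mul_one, ← mul_max_of_nonneg _ _ (abs_nonneg ω), Prod.norm_def, max_comm]
  rfl

theorem norm_rotField (ω x : ℝ) (v : ℂ × ℂ) : ‖rotField ω x v‖ = |ω| * ‖v‖ := by
  have := norm_rotField_sub ω x v 0
  simpa [rotField] using this

/-- The rotating system has a solution from `(1, 0)` on the whole interval. -/
theorem exists_isRotation (ω : ℝ) {T : ℝ} (hT : 0 ≤ T) {φ : ℝ → ℝ}
    (hφ : ContinuousOn φ (Icc 0 T)) :
    ∃ u w, IsRotation (fun _ => ω) φ 0 T u w ∧ u 0 = 1 ∧ w 0 = 0 := by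
  set x₀ : ℂ × ℂ := (1, 0)
  -- The saturated field is bounded by |ω|, so a ball of radius |ω|T lets Picard–Lindelöf cover all
  -- of [0, T] at once.
  set a : NNReal := Real.nnabs ω * T.toNNReal with ha
  obtain ⟨K, hK⟩ :=
    (contDiff_saturation.contDiffOn (s := Metric.closedBall x₀ a)).exists_lipschitzOnWith
      one_ne_zero (convex_closedBall _ _) (isCompact_closedBall _ _)
  have hPL : IsPicardLindelof (fun t x => rotField ω (φ t) (saturation x))
      (⟨0, left_mem_Icc.2 hT⟩ : Icc (0 : ℝ) T) x₀ a 0 (Real.nnabs ω)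
      (Real.nnabs ω * K) := by
    refine ⟨fun t _ => ?_, fun x _ => ?_, fun t _ x _ => ?_, ?_⟩
    · refine LipschitzOnWith.of_dist_le_mul fun x hx y hy => ?_
      rw [dist_eq_norm, norm_rotField_sub, NNReal.coe_mul, Real.coe_nnabs, mul_assoc,
        ← dist_eq_norm]
      exact mul_le_mul_of_nonneg_left (hK.dist_le_mul x hx y hy) (abs_nonneg _)
    · have h1 : ContinuousOn (fun t => (φ t : ℂ)) (Icc 0 T) :=
        continuous_ofReal.comp_continuousOn hφ
      unfold rotField
      fun_prop
    · rw [norm_rotField]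
      exact mul_le_of_le_one_right (abs_nonneg _) (norm_saturation_le x)
    · simp [ha, hT]
  obtain ⟨α, hα0, hα⟩ := hPL.exists_eq_forall_mem_Icc_hasDerivWithinAt₀
  have hα0 : α 0 = x₀ := hα0
  -- The saturated solution is a rotation with variable real speed. Its norm is therefore conserved,
  -- which forces the speed to be ω.
  have hrot : IsRotation (fun t => ω * (2 / (1 + ‖(α t).1‖ ^ 2 + ‖(α t).2‖ ^ 2))) φ 0 T
      (fun t => (α t).1) (fun t => (α t).2) := by
    intro t ht
    have h1 := (ContinuousLinearMap.fst ℝ ℂ ℂ).hasFDerivAt.comp_hasDerivWithinAt t (hα t ht)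
    have h2 := (ContinuousLinearMap.snd ℝ ℂ ℂ).hasFDerivAt.comp_hasDerivWithinAt t (hα t ht)
    constructor
    · convert! h1 using 1
      simp [rotField, saturation]; ring
    · convert! h2 using 1
      simp [rotField, saturation]; ring
  refine ⟨fun t => (α t).1, fun t => (α t).2, fun t ht => ?_, by simp [hα0, x₀],
    by simp [hα0, x₀]⟩
  have hn := hrot.unit_norm (by rw [hα0]) (by rw [hα0]) ht
  have h1 : ω * (2 / (1 + ‖(α t).1‖ ^ 2 + ‖(α t).2‖ ^ 2)) = ω := by
    rw [add_assoc, hn]; norm_num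
  simpa only [h1] using hrot t ht

theorem hasDerivWithinAt_matrix_iff {f : ℝ → Matrix (Fin 2) (Fin 2) ℂ}
    {f' : Matrix (Fin 2) (Fin 2) ℂ} {s : Set ℝ} {t : ℝ} :
    HasDerivWithinAt f f' s t ↔ ∀ i j, HasDerivWithinAt (fun r => f r i j) (f' i j) s t := by
  exact hasDerivWithinAt_pi.trans (forall_congr' fun i => hasDerivWithinAt_pi)

theorem hamiltonian_eq (ω : ℝ) (φ : ℝ → ℝ) (t : ℝ) :
    hamiltonian ω φ t = !![0, ω * exp (-(φ t * I)); ω * exp (φ t * I), 0] := by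
  have h1 : exp (-(φ t * I)) = Real.cos (φ t) - Real.sin (φ t) * I := by
    rw [← neg_mul, exp_mul_I, ofReal_cos, ofReal_sin]; simp; ring
  have h2 : exp (φ t * I) = Real.cos (φ t) + Real.sin (φ t) * I := by
    rw [exp_mul_I, ofReal_cos, ofReal_sin]
  rw [h1, h2]
  ext i j
  fin_cases i <;> fin_cases j <;> simp [hamiltonian, pauliX, pauliY, sub_eq_add_neg]

theorem exists_isPropagator (ω : ℝ) {T : ℝ} (hT : 0 ≤ T) {φ : ℝ → ℝ}
    (hφ : ContinuousOn φ (Icc 0 T)) : ∃ U, IsPropagator T ω φ U := by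
  obtain ⟨u, w, h, hu, hw⟩ := exists_isRotation ω hT hφ
  -- This is V(t) V(s)* conjugated by diag(1, -i), where V has columns (u, w) and its dual (-conj w,
  -- conj u).
  refine ⟨fun t s => !![u t * conj (u s) + conj (w t) * w s,
    I * (u t * conj (w s) - conj (w t) * u s);
    -I * (w t * conj (u s) - conj (u t) * w s), w t * conj (w s) + conj (u t) * u s],
    fun s hs => ⟨?_, fun t ht => ?_⟩⟩
  · have hn := h.norm_conserved hs
    simp only [hu, hw, map_one, map_zero, mul_one, mul_zero, add_zero] at hn
    ext i j
    fin_cases i <;> fin_cases j <;> simp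
    · linear_combination hn
    · ring
    · ring
    · linear_combination hn
  · have hsub : Icc s T ⊆ Icc 0 T := Icc_subset_Icc_left hs.1
    have h1 := (h t (hsub ht)).1.mono hsub
    have h2 := (h t (hsub ht)).2.mono hsub
    have h3 := (h.dual t (hsub ht)).1.mono hsub
    have h4 := (h.dual t (hsub ht)).2.mono hsub
    rw [hasDerivWithinAt_matrix_iff, hamiltonian_eq]
    intro i j
    fin_cases i <;> fin_cases j
    · convert! (h1.mul_const (conj (u s))).sub (h3.mul_const (w s)) using 1
      · ext r; simp
      · simp
        linear_combination
          (ω * exp (-(φ t * I)) * (w t * conj (u s) - conj (u t) * w s)) * I_sq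
    · convert! ((h1.mul_const (conj (w s))).add (h3.mul_const (u s))).const_mul I using 1
      · ext r; simp; ring
      · simp; ring
    · convert! ((h2.mul_const (conj (u s))).sub (h4.mul_const (w s))).const_mul (-I) using 1
      · simp; ring
    · convert! (h2.mul_const (conj (w s))).add (h4.mul_const (u s)) using 1
      · simp
        linear_combination
          (-ω * exp (φ t * I) * (u t * conj (w s) - conj (w t) * u s)) * I_sq

/-! ### Propagators as rotations -/

/-- Rescaled to unit length and rotated by a fixed angle, the columns of a propagator solve the
rotating system. -/
theorem IsPropagator.isRotation {T ω : ℝ} {φ : ℝ → ℝ} {U : ℝ → ℝ → Matrix (Fin 2) (Fin 2) ℂ}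
    (hU : IsPropagator T ω φ U) {s h : ℝ} (hs : 0 ≤ s) (hh : 0 ≤ h) (hsh : s + h ≤ T) (m : ℝ)
    (j : Fin 2) :
    IsRotation (fun _ => ω * h) (fun r => φ (s + h * r) - m) 0 1 (fun r => U (s + h * r) s 0 j)
      (fun r => I * exp (-(m * I)) * U (s + h * r) s 1 j) := by
  intro r hr
  have hm : MapsTo (fun r : ℝ => s + h * r) (Icc 0 1) (Icc s T) := fun x hx =>
    ⟨by nlinarith [hx.1], by nlinarith [hx.2]⟩
  have hd : HasDerivWithinAt (fun r : ℝ => s + h * r) h (Icc 0 1) r := by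
    simpa using (((hasDerivAt_id r).const_mul h).const_add s).hasDerivWithinAt
  have h1 := hasDerivWithinAt_matrix_iff.1 ((hU s ⟨hs, by linarith⟩).2 _ (hm hr))
  rw [hamiltonian_eq] at h1
  have he : exp (-(m * I)) * exp (m * I) = 1 := by rw [← exp_add]; simp
  have e1 : exp (-(((φ (s + h * r) - m : ℝ) : ℂ) * I)) =
      exp (-(φ (s + h * r) * I)) * exp (m * I) := by
    rw [← exp_add]; congr 1; push_cast; ring
  have e2 : exp (((φ (s + h * r) - m : ℝ) : ℂ) * I) =
      exp (φ (s + h * r) * I) * exp (-(m * I)) := by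
    rw [← exp_add]; congr 1; push_cast; ring
  constructor
  · convert! HasDerivWithinAt.scomp r (h1 0 j) hd hm using 1
    rw [e1]
    simp [Matrix.vecMul, dotProduct, Fin.sum_univ_two]
    linear_combination (ω * h * exp (-(φ (s + h * r) * I)) * I * U (s + h * r) s 1 j) * he
  · convert! (HasDerivWithinAt.scomp r (h1 1 j) hd hm).const_mul (I * exp (-(m * I))) using 1
    rw [e2]
    simp [Matrix.vecMul, dotProduct, Fin.sum_univ_two]
    linear_combination
      (ω * h * exp (φ (s + h * r) * I) * exp (-(m * I)) * U (s + h * r) s 0 j) * I_sq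

/-- Propagators are special unitary. -/
theorem IsPropagator.eq_special_unitary {T ω : ℝ} {φ : ℝ → ℝ}
    {U : ℝ → ℝ → Matrix (Fin 2) (Fin 2) ℂ} (hU : IsPropagator T ω φ U) {s h : ℝ} (hs : 0 ≤ s)
    (hh : 0 ≤ h) (hsh : s + h ≤ T) :
    U (s + h) s = !![U (s + h) s 0 0, -conj (U (s + h) s 1 0);
      U (s + h) s 1 0, conj (U (s + h) s 0 0)] ∧
    U (s + h) s 0 0 * conj (U (s + h) s 0 0) + U (s + h) s 1 0 * conj (U (s + h) s 1 0) = 1 := by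
  have h0 := hU.isRotation hs hh hsh 0 0
  have h1 := hU.isRotation hs hh hsh 0 1
  have hr := right_mem_Icc.2 (zero_le_one' ℝ)
  have hn := h0.norm_conserved hr
  have hi := h0.inner_conserved h1 hr
  have hw := h0.wronskian h1 hr
  have hU1 := (hU s ⟨hs, by linarith⟩).1
  simp [hU1] at hn hi hw
  generalize U (s + h) s = V at *
  have hI : I * I = -1 := I_mul_I
  have hn' : V 0 0 * conj (V 0 0) + V 1 0 * conj (V 1 0) = 1 := by
    linear_combination hn + (V 1 0 * conj (V 1 0)) * hI
  have hi' : conj (V 0 0) * V 0 1 + conj (V 1 0) * V 1 1 = 0 := by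
    linear_combination hi + (conj (V 1 0) * V 1 1) * hI
  have hw' : V 0 0 * V 1 1 - V 1 0 * V 0 1 = 1 := by
    linear_combination (-I) * hw + (V 0 0 * V 1 1 - V 1 0 * V 0 1 - 1) * hI
  refine ⟨?_, hn'⟩
  ext i j
  fin_cases i <;> fin_cases j <;> simp
  · linear_combination (-V 0 1) * hn' + V 0 0 * hi' - conj (V 1 0) * hw'
  · linear_combination (-V 1 1) * hn' + V 1 0 * hi' + conj (V 0 0) * hw'

/-! ### Regularity of the pulse -/

namespace IsBernsteinPulse

variable {C β T : ℝ} {φ : ℝ → ℝ}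

theorem abs_derivWithin_le (hφ : IsBernsteinPulse C β T φ) {t : ℝ} (ht : t ∈ Icc 0 T) :
    |derivWithin φ (Icc 0 T) t| ≤ C * β := by
  have := hφ.2 1 t ht
  rwa [iteratedDerivWithin_one, pow_one] at this

theorem abs_sub_le (hφ : IsBernsteinPulse C β T φ) {x y : ℝ} (hx : x ∈ Icc 0 T)
    (hy : y ∈ Icc 0 T) : |φ y - φ x| ≤ C * β * |y - x| :=
  (convex_Icc 0 T).norm_image_sub_le_of_norm_derivWithin_le
    (hφ.1.differentiableOn (by simp)) (fun _ hx => hφ.abs_derivWithin_le hx) hx hy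

theorem abs_derivWithin_sub_le (hφ : IsBernsteinPulse C β T φ) (hT : 0 < T) {x y : ℝ}
    (hx : x ∈ Icc 0 T) (hy : y ∈ Icc 0 T) :
    |derivWithin φ (Icc 0 T) y - derivWithin φ (Icc 0 T) x| ≤ C * β ^ 2 * |y - x| := by
  have hd : DifferentiableOn ℝ (derivWithin φ (Icc 0 T)) (Icc 0 T) := by
    have := hφ.1.differentiableOn_iteratedDerivWithin (m := 1) (by simp) (uniqueDiffOn_Icc hT)
    rwa [iteratedDerivWithin_one] at this
  refine (convex_Icc 0 T).norm_image_sub_le_of_norm_derivWithin_le hd (fun t ht => ?_) hx hy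
  have := hφ.2 2 t ht
  rwa [iteratedDerivWithin_succ, iteratedDerivWithin_one] at this

/-- The derivative of the symmetrised pulse is a difference of φ' at mirrored points, so the second
derivative of φ controls it. -/
theorem abs_add_reverse_sub_le (hφ : IsBernsteinPulse C β T φ) (hT : 0 < T) {s h : ℝ}
    (hs : 0 ≤ s) (hh : 0 ≤ h) (hsh : s + h ≤ T) (hC : 0 ≤ C) {r q : ℝ} (hr : r ∈ Icc (0 : ℝ) 1)
    (hq : q ∈ Icc (0 : ℝ) 1) :
    |φ (s + h * r) + φ (s + h * (1 - r)) - (φ (s + h * q) + φ (s + h * (1 - q)))| ≤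
      C * (β * h) ^ 2 := by
  have hm : MapsTo (fun r : ℝ => s + h * r) (Icc 0 1) (Icc 0 T) := fun x hx =>
    ⟨by nlinarith [hx.1], by nlinarith [hx.2]⟩
  have hm1 : MapsTo (fun r : ℝ => 1 - r) (Icc 0 1) (Icc 0 1) := fun x hx =>
    ⟨by linarith [hx.2], by linarith [hx.1]⟩
  have hφd : ∀ t ∈ Icc 0 T, HasDerivWithinAt φ (derivWithin φ (Icc 0 T) t) (Icc 0 T) t :=
    fun t ht => (hφ.1.differentiableOn (by simp) t ht).hasDerivWithinAt
  have hd : ∀ r ∈ Icc (0 : ℝ) 1, HasDerivWithinAt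
      (fun r => φ (s + h * r) + φ (s + h * (1 - r)))
      (h * (derivWithin φ (Icc 0 T) (s + h * r) - derivWithin φ (Icc 0 T) (s + h * (1 - r))))
      (Icc 0 1) r := fun r hr => by
    have h1 : HasDerivWithinAt (fun r : ℝ => s + h * r) h (Icc 0 1) r := by
      simpa using (((hasDerivAt_id r).const_mul h).const_add s).hasDerivWithinAt
    have h2 : HasDerivWithinAt (fun r : ℝ => s + h * (1 - r)) (-h) (Icc 0 1) r := by
      simpa using ((((hasDerivAt_id r).const_sub 1).const_mul h).const_add s).hasDerivWithinAt
    convert! (HasDerivWithinAt.scomp r (hφd _ (hm hr)) h1 hm).add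
      (HasDerivWithinAt.scomp r (hφd _ (hm (hm1 hr))) h2 (hm.comp hm1)) using 1
    simp only [smul_eq_mul]
    ring
  have hb : ∀ r ∈ Icc (0 : ℝ) 1, ‖h * (derivWithin φ (Icc 0 T) (s + h * r) -
      derivWithin φ (Icc 0 T) (s + h * (1 - r)))‖ ≤ C * (β * h) ^ 2 := fun r hr => by
    have h1 := hφ.abs_derivWithin_sub_le hT (hm (hm1 hr)) (hm hr)
    have h2 : |s + h * r - (s + h * (1 - r))| ≤ h := by
      rw [abs_le]
      constructor <;> nlinarith [hr.1, hr.2]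
    rw [norm_mul, Real.norm_of_nonneg hh, Real.norm_eq_abs]
    calc h * _ ≤ h * (C * β ^ 2 * h) := by
          refine mul_le_mul_of_nonneg_left (h1.trans ?_) hh
          exact mul_le_mul_of_nonneg_left h2 (by positivity)
      _ = _ := by ring
  refine ((convex_Icc (0 : ℝ) 1).norm_image_sub_le_of_norm_hasDerivWithin_le hd hb hq hr).trans ?_
  refine mul_le_of_le_one_right (by positivity) ?_
  rw [Real.norm_eq_abs, abs_le]
  constructor <;> linarith [hr.1, hr.2, hq.1, hq.2]

end IsBernsteinPulse

/-! ### The phase of a segment propagator -/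

/-- A function of zero mean is bounded by its oscillation. -/
theorem abs_le_of_integral_eq_zero {f : ℝ → ℝ} (hf : Continuous f)
    (h0 : ∫ s in (0 : ℝ)..1, f s = 0) {B : ℝ} {r : ℝ}
    (hB : ∀ q ∈ Icc (0 : ℝ) 1, |f r - f q| ≤ B) : |f r| ≤ B := by
  have h1 : ∫ q in (0 : ℝ)..1, (f r - f q) = f r := by
    rw [intervalIntegral.integral_sub (by simp) (hf.intervalIntegrable _ _), h0]
    simp
  have h2 := intervalIntegral.norm_integral_le_of_norm_le_const (a := 0) (b := 1) (C := B)
    (f := fun q => f r - f q) (fun q hq => by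
      rw [uIoc_of_le zero_le_one] at hq
      exact hB q (Ioc_subset_Icc_self hq))
  rw [h1] at h2
  simpa using h2

/-- The off-diagonal entry of a short propagator has the mean pulse as its phase, to fourth
order. -/
theorem exists_segment_polar {C Θ : ℝ} (hC : 0 ≤ C) (hΘ0 : 0 < Θ) (hΘ : Θ < Real.pi) :
    ∃ K : ℝ, 0 < K ∧ ∃ ε : ℝ, 0 < ε ∧ ∀ {β T ω s h : ℝ} {φ : ℝ → ℝ}
      {U : ℝ → ℝ → Matrix (Fin 2) (Fin 2) ℂ}, 0 < β → 0 < ω → 0 < h → 0 ≤ s → s + h ≤ T →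
      ω * h ≤ Θ → β * h ≤ ε → IsBernsteinPulse C β T φ → IsPropagator T ω φ U →
      ∃ ρ : ℝ, 0 < ρ ∧ ∃ η : ℝ,
        I * U (s + h) s 1 0 =
          (ρ : ℂ) * exp (((h⁻¹ * ∫ x in s..s + h, φ x) + η : ℝ) * I) ∧
        |η| ≤ K * (((β * h) ^ 2 + (ω * h) ^ 2) * (β * h) ^ 2) := by
  obtain ⟨K, hK, ε, hε, key⟩ := IsRotation.exists_polar hC hΘ0 hΘ
  refine ⟨K, hK, ε, hε, ?_⟩
  intro β T ω s h φ U hβ hω hh hs hsT hωh hβh hφ hU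
  have hT : 0 < T := by linarith
  set m := h⁻¹ * ∫ x in s..s + h, φ x with hmdef
  -- The pulse is controlled only on [0, T]; a continuous extension supplies the global continuity
  -- of δ.
  set ψ : ℝ → ℝ := IccExtend hT.le (fun t : Icc 0 T => φ t) with hψ
  have hψc : Continuous ψ :=
    (continuousOn_iff_continuous_domRestrict.1 hφ.1.continuousOn).Icc_extend'
  have hψφ : ∀ t ∈ Icc 0 T, ψ t = φ t := fun t ht => IccExtend_of_mem hT.le _ ht
  have hm : ∀ r ∈ Icc (0 : ℝ) 1, s + h * r ∈ Icc 0 T := fun r hr =>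
    ⟨by nlinarith [hr.1], by nlinarith [hr.2]⟩
  have hm1 : ∀ r ∈ Icc (0 : ℝ) 1, 1 - r ∈ Icc (0 : ℝ) 1 := fun r hr =>
    ⟨by linarith [hr.2], by linarith [hr.1]⟩
  set δ : ℝ → ℝ := fun r => ψ (s + h * r) - m with hδ
  have hδc : Continuous δ := by fun_prop
  have hmean : ∫ r in (0 : ℝ)..1, δ r = 0 := by
    have h1 : ∫ x in s..s + h, φ x = ∫ x in s..s + h, ψ x := by
      refine intervalIntegral.integral_congr fun x hx => ?_
      rw [uIcc_of_le (by linarith)] at hx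
      exact (hψφ x ⟨hs.trans hx.1, hx.2.trans hsT⟩).symm
    have h2 : ∫ r in (0 : ℝ)..1, ψ (s + h * r) = m := by
      rw [intervalIntegral.integral_comp_add_mul ψ hh.ne', hmdef, h1]
      simp
    have h3 : Continuous fun r => ψ (s + h * r) := by fun_prop
    rw [intervalIntegral.integral_sub (h3.intervalIntegrable _ _) (by simp), h2]
    simp
  have hD : ∀ r ∈ Icc (0 : ℝ) 1, |δ r| ≤ C * (β * h) := fun r hr => by
    refine abs_le_of_integral_eq_zero hδc hmean fun q hq => ?_
    rw [hδ]
    simp only [sub_sub_sub_cancel_right]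
    rw [hψφ _ (hm r hr), hψφ _ (hm q hq)]
    refine (hφ.abs_sub_le (hm q hq) (hm r hr)).trans ?_
    have : |s + h * r - (s + h * q)| ≤ h := by
      rw [abs_le]
      constructor <;> nlinarith [hr.1, hr.2, hq.1, hq.2]
    rw [← mul_assoc]
    gcongr
  have hE : ∀ r ∈ Icc (0 : ℝ) 1, |δ r + δ (1 - r)| ≤ C * (β * h) ^ 2 := fun r hr => by
    have hc : Continuous fun r => δ (1 - r) := by fun_prop
    have h0 : ∫ r in (0 : ℝ)..1, (δ r + δ (1 - r)) = 0 := by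
      rw [intervalIntegral.integral_add (hδc.intervalIntegrable _ _) (hc.intervalIntegrable _ _),
        intervalIntegral.integral_comp_sub_left (fun s => δ s) 1]
      simp [hmean]
    refine abs_le_of_integral_eq_zero (hδc.add hc) h0 fun q hq => ?_
    have h1 := hφ.abs_add_reverse_sub_le hT hs hh.le hsT hC hr hq
    rw [← hψφ _ (hm r hr), ← hψφ _ (hm q hq), ← hψφ _ (hm _ (hm1 r hr)),
      ← hψφ _ (hm _ (hm1 q hq))] at h1
    convert! h1 using 2
    simp only [hδ, Pi.add_apply]
    ring
  have hrot : IsRotation (fun _ => ω * h) δ 0 1 (fun r => U (s + h * r) s 0 0)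
      (fun r => I * exp (-(m * I)) * U (s + h * r) s 1 0) := fun r hr => by
    simpa only [hδ, hψφ _ (hm r hr)] using hU.isRotation hs hh.le hsT m 0 r hr
  have hU1 := (hU s ⟨hs, by linarith⟩).1
  obtain ⟨ρ, hρ, η, hη, hηle⟩ := key (mul_pos hω hh) hωh (mul_pos hβ hh) hβh hrot
    (by simp [hU1]) (by simp [hU1]) hδc hD hE hmean
  refine ⟨ρ, hρ, η, ?_, hηle⟩
  rw [mul_one] at hη
  have h1 : exp (m * I) * exp (-(m * I)) = 1 := by rw [← exp_add]; simp
  calc I * U (s + h) s 1 0 = exp (m * I) * (I * exp (-(m * I)) * U (s + h) s 1 0) := by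
        linear_combination (-I * U (s + h) s 1 0) * h1
    _ = ρ * (exp (m * I) * exp (η * I)) := by rw [hη]; ring
    _ = _ := by
        rw [← exp_add]
        congr 2
        push_cast
        ring

/-! ### From the phase to the estimators -/

/-- Only the ratio b/a enters, so σ may have either sign and the generator need not be principal. -/
theorem arctan_div_eq {a b σ ρ m η κ : ℝ} (hρ : 0 < ρ)
    (h : (σ * (a + b * I) : ℂ) = ρ * exp ((m + η : ℝ) * I)) (hm : |m| < Real.pi / 2)
    (hκ : κ ≤ Real.cos m) (hη : |η| < κ) : Real.arctan (b / a) = m + η := by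
  have hre : σ * a = ρ * Real.cos (m + η) := by
    have := congrArg re h
    rw [re_ofReal_mul, re_ofReal_mul, exp_ofReal_mul_I_re] at this
    simpa using this
  have him : σ * b = ρ * Real.sin (m + η) := by
    have := congrArg im h
    rw [im_ofReal_mul, im_ofReal_mul, exp_ofReal_mul_I_im] at this
    simpa using this
  -- From κ ≤ cos m = sin(π/2 - |m|) ≤ π/2 - |m|: a perturbation below κ stays in the branch of
  -- `arctan`.
  have hm' : |m| + κ ≤ Real.pi / 2 := by
    have h1 := Real.sin_le (x := Real.pi / 2 - |m|) (by linarith)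
    rw [Real.sin_pi_div_two_sub, Real.cos_abs] at h1
    linarith
  have hmη : |m + η| < Real.pi / 2 := (abs_add_le _ _).trans_lt (by linarith)
  have hcos : 0 < Real.cos (m + η) := Real.cos_pos_of_mem_Ioo (abs_lt.1 hmη)
  have hσ : σ ≠ 0 := by
    rintro rfl
    rw [zero_mul] at hre
    exact (mul_pos hρ hcos).ne hre
  have hdiv : b / a = Real.tan (m + η) := by
    rw [← mul_div_mul_left b a hσ, hre, him, mul_div_mul_left _ _ hρ.ne', Real.tan_eq_sin_div_cos]
  rw [hdiv, Real.arctan_tan (abs_lt.1 hmη).1 (abs_lt.1 hmη).2]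

/-- The polar angle does see the sign of σ; positivity of sinc r is what the principal range
provides. -/
theorem exists_atan2_eq {a b σ ρ θ : ℝ} (hρ : 0 < ρ) (hσ : 0 < σ)
    (h : (σ * (a + b * I) : ℂ) = ρ * exp (θ * I)) :
    ∃ k : ℤ, atan2 b a + 2 * Real.pi * k = θ := by
  have h1 : (⟨a, b⟩ : ℂ) = ((ρ / σ : ℝ) : ℂ) * (cos θ + sin θ * I) := by
    have : (σ : ℂ) ≠ 0 := by exact_mod_cast hσ.ne'
    rw [← exp_mul_I, mk_eq_add_mul_I]
    rw [ofReal_div, div_mul_eq_mul_div, eq_div_iff this, mul_comm, h]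
  have h2 := arg_mul_cos_add_sin_mul_I_sub (div_pos hρ hσ) θ
  refine ⟨-⌊(Real.pi - θ) / (2 * Real.pi)⌋, ?_⟩
  rw [atan2, h1]
  rw [Int.cast_neg]
  linarith

theorem exists_abs_add_two_pi_mul_sub_le (x m : ℝ) :
    ∃ k : ℤ, |x + 2 * Real.pi * k - m| ≤ Real.pi := by
  refine ⟨round ((m - x) / (2 * Real.pi)), ?_⟩
  have h := abs_sub_round ((m - x) / (2 * Real.pi))
  have hpi := Real.pi_pos
  calc |x + 2 * Real.pi * round ((m - x) / (2 * Real.pi)) - m|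
      = |-(2 * Real.pi) * ((m - x) / (2 * Real.pi) - round ((m - x) / (2 * Real.pi)))| := by
        congr 1; field_simp; ring
    _ = 2 * Real.pi * |(m - x) / (2 * Real.pi) - round ((m - x) / (2 * Real.pi))| := by
        rw [abs_mul, abs_neg, abs_of_pos (by positivity)]
    _ ≤ 2 * Real.pi * (1 / 2) := by gcongr
    _ = _ := by ring

theorem sinc_mul_eq_of_eq_expPauli {a b c : ℝ} {V : Matrix (Fin 2) (Fin 2) ℂ}
    (hV : V = expPauli a b c) :
    (Real.sinc √(a ^ 2 + b ^ 2 + c ^ 2) * (a + b * I) : ℂ) = I * V 1 0 := by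
  rw [hV, expPauli_eq a b c _ (Real.sq_sqrt (by positivity))]
  simp only [Matrix.of_apply, Matrix.cons_val', Matrix.cons_val_zero, Matrix.cons_val_one,
    Matrix.cons_val_fin_one]
  linear_combination (Real.sinc √(a ^ 2 + b ^ 2 + c ^ 2) * (a + b * I)) * I_sq

/-- Estimator bounds on a single segment. -/
theorem exists_estimator_bound {C κ Θ : ℝ} (hC : 0 ≤ C) (hκ : 0 < κ) (hΘ0 : 0 < Θ)
    (hΘ : Θ < Real.pi) :
    ∃ K : ℝ, 0 < K ∧ ∀ {β T ω s h : ℝ} {φ : ℝ → ℝ} {U : ℝ → ℝ → Matrix (Fin 2) (Fin 2) ℂ} {m : ℝ},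
      0 < β → 0 < ω → 0 < h → 0 ≤ s → s + h ≤ T → ω * h ≤ Θ → IsBernsteinPulse C β T φ →
      IsPropagator T ω φ U → m = h⁻¹ * ∫ x in s..s + h, φ x →
      ∀ {a b c : ℝ}, U (s + h) s = expPauli a b c →
      (|m| < Real.pi / 2 → κ ≤ Real.cos m →
        |Real.arctan (b / a) - m| ≤ K * (((β * h) ^ 2 + (ω * h) ^ 2) * (β * h) ^ 2) ∧
        |Real.arctan (b / a) - m| ≤ K * (β * h) ^ 2) ∧
      (a ^ 2 + b ^ 2 + c ^ 2 < Real.pi ^ 2 → ∃ k : ℤ,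
        |atan2 b a + 2 * Real.pi * k - m| ≤ K * (((β * h) ^ 2 + (ω * h) ^ 2) * (β * h) ^ 2) ∧
        |atan2 b a + 2 * Real.pi * k - m| ≤ K * (β * h) ^ 2) := by
  obtain ⟨K₁, hK₁, ε₁, hε₁, key⟩ := exists_segment_polar hC hΘ0 hΘ
  have hpi := Real.pi_pos
  set M := K₁ * (1 + Θ ^ 2) with hM
  have hM0 : 0 < M := by positivity
  -- For x ≤ ε the error is at most M x² ≤ M x ≤ κ/2, below κ. For x > ε the summand π/ε⁴ of K lifts
  -- both bounds above π.
  set ε := min (min ε₁ 1) (κ / (2 * M)) with hε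
  have hε0 : 0 < ε := by positivity
  have hε1 : ε ≤ 1 := (min_le_left _ _).trans (min_le_right _ _)
  refine ⟨M + Real.pi / ε ^ 4, by positivity, ?_⟩
  intro β T ω s h φ U m hβ hω hh hs hsT hωh hφ hU hmdef a b c hV
  set x := β * h with hx
  have hx0 : 0 < x := mul_pos hβ hh
  set τ := ω * h with hτ
  have hτ0 : 0 < τ := mul_pos hω hh
  have hX : 0 ≤ (x ^ 2 + τ ^ 2) * x ^ 2 := by positivity
  rcases le_or_gt x ε with hxε | hxε
  · obtain ⟨ρ, hρ, η, hpol, hη⟩ := key hβ hω hh hs hsT hωh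
      (hxε.trans ((min_le_left _ _).trans (min_le_left _ _))) hφ hU
    rw [← hmdef, ← sinc_mul_eq_of_eq_expPauli hV] at hpol
    have hx1 : x ≤ 1 := hxε.trans hε1
    have hη1 : |η| ≤ (M + Real.pi / ε ^ 4) * ((x ^ 2 + τ ^ 2) * x ^ 2) := by
      refine hη.trans (mul_le_mul_of_nonneg_right ?_ hX)
      have : 0 ≤ Real.pi / ε ^ 4 := by positivity
      nlinarith [mul_nonneg hK₁.le (sq_nonneg Θ)]
    have hη2 : |η| ≤ M * x ^ 2 := by
      calc |η| ≤ K₁ * ((x ^ 2 + τ ^ 2) * x ^ 2) := hη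
        _ ≤ K₁ * ((1 ^ 2 + Θ ^ 2) * x ^ 2) := by gcongr
        _ = _ := by rw [hM]; ring
    have hη3 : |η| ≤ (M + Real.pi / ε ^ 4) * x ^ 2 := by
      refine hη2.trans ?_
      gcongr
      exact le_add_of_nonneg_right (by positivity)
    have hηκ : |η| < κ := by
      have h1 : x * (2 * M) ≤ κ := by
        have := hxε.trans (min_le_right _ _)
        rwa [le_div_iff₀ (by positivity)] at this
      have h2 : M * x ^ 2 ≤ M * x := by
        gcongr
        nlinarith
      linarith
    constructor
    · intro hm hκm
      rw [arctan_div_eq hρ hpol hm hκm hηκ, add_sub_cancel_left]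
      exact ⟨hη1, hη3⟩
    · intro hr
      have hsq : √(a ^ 2 + b ^ 2 + c ^ 2) < Real.pi := by
        rw [Real.sqrt_lt' hpi]; exact hr
      obtain ⟨k, hk⟩ := exists_atan2_eq hρ
        (sinc_pos_of_abs_lt_pi (Real.sqrt_nonneg _) hsq) hpol
      refine ⟨k, ?_⟩
      rw [hk, add_sub_cancel_left]
      exact ⟨hη1, hη3⟩
  · have h1 : Real.pi ≤ (M + Real.pi / ε ^ 4) * ((x ^ 2 + τ ^ 2) * x ^ 2) := by
      calc Real.pi = Real.pi / ε ^ 4 * ((ε ^ 2 + 0) * ε ^ 2) := by field_simp; ring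
        _ ≤ (M + Real.pi / ε ^ 4) * ((x ^ 2 + τ ^ 2) * x ^ 2) := by
          gcongr
          · exact le_add_of_nonneg_left hM0.le
          · positivity
    have h2 : Real.pi ≤ (M + Real.pi / ε ^ 4) * x ^ 2 := by
      calc Real.pi = Real.pi / ε ^ 4 * ε ^ 4 := by field_simp
        _ ≤ Real.pi / ε ^ 4 * ε ^ 2 :=
          mul_le_mul_of_nonneg_left (pow_le_pow_of_le_one hε0.le hε1 (by norm_num))
            (by positivity)
        _ ≤ (M + Real.pi / ε ^ 4) * x ^ 2 := by
          gcongr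
          exact le_add_of_nonneg_left hM0.le
    constructor
    · intro hm _
      have h3 : |Real.arctan (b / a) - m| ≤ Real.pi := by
        have h4 := Real.arctan_mem_Ioo (b / a)
        have h5 := abs_lt.1 hm
        rw [abs_le]
        constructor <;> linarith [h4.1, h4.2, h5.1, h5.2]
      exact ⟨h3.trans h1, h3.trans h2⟩
    · intro _
      obtain ⟨k, hk⟩ := exists_abs_add_two_pi_mul_sub_le (atan2 b a) m
      exact ⟨k, hk.trans h1, hk.trans h2⟩

/-- Short propagators have generators in the principal range. -/
theorem IsPropagator.exists_expPauli {T ω : ℝ} {φ : ℝ → ℝ}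
    {U : ℝ → ℝ → Matrix (Fin 2) (Fin 2) ℂ} (hU : IsPropagator T ω φ U) {s h : ℝ} (hs : 0 ≤ s)
    (hω : 0 < ω) (hh : 0 < h) (hsh : s + h ≤ T) (hωh : ω * h < Real.pi) :
    ∃ a b c : ℝ, a ^ 2 + b ^ 2 + c ^ 2 < Real.pi ^ 2 ∧ U (s + h) s = expPauli a b c := by
  obtain ⟨h1, h2⟩ := hU.eq_special_unitary hs hh.le hsh
  have hU1 := (hU s ⟨hs, by linarith⟩).1
  have h3 := (hU.isRotation hs hh.le hsh 0 0).neg_one_lt_re (mul_pos hω hh) hωh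
    (by simp [hU1]) (by simp [hU1])
  rw [mul_one] at h3
  rw [h1]
  exact exists_expPauli_eq _ _ h2 h3

end AnalogPulse

/-! ### The main theorem -/

open AnalogPulse in
theorem theorem3 (C κ Θ : ℝ) (hκ : 0 < κ) (hΘ : Θ < Real.pi) :
    ∃ K : ℝ, 0 < K ∧
      ∀ (β T ω : ℝ) (L : ℕ) (φ : ℝ → ℝ), 0 < β → 0 < T → 0 < ω → 1 ≤ L →
        ω * (T / L) ≤ Θ → IsBernsteinPulse C β T φ →
        -- the propagator exists, and everything below holds for it
        (∃ U, IsPropagator T ω φ U) ∧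
        ∀ U, IsPropagator T ω φ U →
          ∀ j ∈ Finset.Icc 1 L,
            -- every segment propagator has generators, in the principal range
            (∃ a b c : ℝ, a ^ 2 + b ^ 2 + c ^ 2 < Real.pi ^ 2 ∧
              segmentPropagator U (T / L) j = expPauli a b c) ∧
            ∀ a b c : ℝ, segmentPropagator U (T / L) j = expPauli a b c →
              -- the arctan estimator, for averages inside the principal branch
              ((|segmentAverage φ (T / L) j| < Real.pi / 2 →
                κ ≤ Real.cos (segmentAverage φ (T / L) j) →
                |Real.arctan (b / a) - segmentAverage φ (T / L) j|
                    ≤ K * ((β ^ 2 + ω ^ 2) * β ^ 2 * (T / L) ^ 4) ∧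
                |Real.arctan (b / a) - segmentAverage φ (T / L) j|
                    ≤ K * (β ^ 2 * T ^ 2 / (L : ℝ) ^ 2))) ∧
              -- the atan2 estimator, for arbitrary averages, as an angle modulo 2π
              (a ^ 2 + b ^ 2 + c ^ 2 < Real.pi ^ 2 →
                ∃ k : ℤ,
                  |atan2 b a + 2 * Real.pi * k - segmentAverage φ (T / L) j|
                      ≤ K * ((β ^ 2 + ω ^ 2) * β ^ 2 * (T / L) ^ 4) ∧
                  |atan2 b a + 2 * Real.pi * k - segmentAverage φ (T / L) j|
                      ≤ K * (β ^ 2 * T ^ 2 / (L : ℝ) ^ 2)) := by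
  -- Otherwise no data are admissible: the bound for k = 0 forces C ≥ 0, and 0 < ωh ≤ Θ forces Θ >
  -- 0.
  by_cases hCΘ : 0 ≤ C ∧ 0 < Θ
  swap
  · refine ⟨1, one_pos, fun β T ω L φ hβ hT hω hL hΘL hφ => absurd ⟨?_, ?_⟩ hCΘ⟩
    · have := hφ.2 0 0 ⟨le_rfl, hT.le⟩
      rw [pow_zero, mul_one] at this
      exact (abs_nonneg _).trans this
    · have : (0 : ℝ) < L := by exact_mod_cast hL
      exact lt_of_lt_of_le (by positivity) hΘL
  obtain ⟨K, hK, key⟩ := exists_estimator_bound hCΘ.1 hκ hCΘ.2 hΘ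
  refine ⟨K, hK, fun β T ω L φ hβ hT hω hL hΘL hφ =>
    ⟨exists_isPropagator ω hT.le hφ.1.continuousOn, fun U hU j hj => ?_⟩⟩
  have hL0 : (0 : ℝ) < L := by exact_mod_cast hL
  have hj1 : (1 : ℝ) ≤ j := by exact_mod_cast (Finset.mem_Icc.1 hj).1
  have hjL : (j : ℝ) ≤ L := by exact_mod_cast (Finset.mem_Icc.1 hj).2
  set h := T / L with hh
  have hh0 : 0 < h := div_pos hT hL0
  have hs : 0 ≤ ((j : ℝ) - 1) * h := mul_nonneg (by linarith) hh0.le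
  have hend : (j : ℝ) * h = ((j : ℝ) - 1) * h + h := by ring
  have hsT : ((j : ℝ) - 1) * h + h ≤ T := by
    rw [← hend, hh, mul_div_assoc', div_le_iff₀ hL0, mul_comm]
    gcongr
  have hseg : segmentPropagator U h j = U (((j : ℝ) - 1) * h + h) (((j : ℝ) - 1) * h) := by
    rw [segmentPropagator, hend]
  have havg : segmentAverage φ h j =
      h⁻¹ * ∫ x in (((j : ℝ) - 1) * h)..(((j : ℝ) - 1) * h + h), φ x := by
    rw [segmentAverage, hend]
  have e1 : (β ^ 2 + ω ^ 2) * β ^ 2 * h ^ 4 = ((β * h) ^ 2 + (ω * h) ^ 2) * (β * h) ^ 2 := by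
    ring
  have e2 : β ^ 2 * T ^ 2 / (L : ℝ) ^ 2 = (β * h) ^ 2 := by
    rw [hh]; ring
  rw [hseg, e1, e2]
  exact ⟨hU.exists_expPauli hs hω hh0 hsT (hΘL.trans_lt hΘ), fun a b c hV =>
    key hβ hω hh0 hs hsT hΘL hφ hU havg hV⟩
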